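/- \textbf{Corollary (Einstein + condition (i) $\Rightarrow$ isoparametric).} Let $(N,h)$ be a smooth Riemannian manifold of dimension $n>2$ (second countable, Hausdorff, without boundary) which is Einstein, i.e. $\mathrm{Ricci}=c\,\mathrm{id}$ for a constant $c\in\mathbb R$, where $\mathrm{Ricci}(v)=\sum_i R(v,e_i)e_i$ and $R(X,Y)Z=\nabla_X\nabla_YZ-\nabla_Y\nabla_XZ-\nabla_{[X,Y]}Z$. Let $\rho\in C^\infty(N)$ be such that at every point where $\mathrm{grad}\,\rho\neq 0$, $$\text{(i)}\qquad \mathrm{grad}\,|\mathrm{grad}\,\rho|\ \text{ is parallel to (a real multiple of) }\ \mathrm{grad}\,\rho .$$ Suppose that $\alpha=d\rho$ satisfies on $N$ the equation $$-\Delta\alpha+\frac{6-n}{2}\,d|\alpha|^2+\big(2\,d^*\alpha+(2-n)|\alpha|^2\big)\alpha+2(\mathrm{Ricci}\,\alpha^\sharp)^\flat=0,$$ where $d^*$ is the codifferential and $\Delta=dd^*+d^*d$ is the Hodge Laplacian (so $\Delta f=d^*df=-\mathrm{trace}\,\nabla df$ on functions). Then $\rho$ is isoparametric near each of its regular points and,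 more precisely: (a) every point $q$ with $\mathrm{grad}_q\rho\neq0$ has an open neighbourhood $U$, free of critical points of $\rho$, on which there are smooth functions $\gamma,\sigma$ on $\rho(U)\subset\mathbb R$ with $$|d\rho|^2=\gamma\circ\rho,\qquad \Delta\rho=\sigma\circ\rho\qquad\text{on }U;$$ (b) such smooth functions $\gamma,\sigma$ on $\rho(U)$ exist on every open set $U\subset N$ that is free of critical points of $\rho$ and on which all level sets $U\cap\rho^{-1}(t)$, $t\in\mathbb R$, are connected (or empty). In particular, if the level sets of $\rho$ in $\{\mathrm{grad}\,\rho\neq0\}$ are connected, then a single pair $\gamma,\sigma$ works at all points where $\mathrm{grad}\,\rho\neq0$. -/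

import Mathlib

open Bundle
open scoped Manifold ContDiff InnerProductSpace

namespace Riem

noncomputable section

variable {E : Type*} [NormedAddCommGroup E] [NormedSpace ℝ E] [FiniteDimensional ℝ E]
  {H : Type*} [TopologicalSpace H] (I : ModelWithCorners ℝ E H)
  {N : Type*} [TopologicalSpace N] [ChartedSpace H N]

instance tangentFiniteDimensional (x : N) : FiniteDimensional ℝ (TangentSpace I x) :=
  inferInstanceAs (FiniteDimensional ℝ E)

/-- The differential of a function, as a 1-form. -/
def d (f : N → ℝ) (x : N) : TangentSpace I x →L[ℝ] ℝ := mvfderiv I f x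

section Metric

variable [RiemannianBundle (fun x : N ↦ TangentSpace I x)]

/-- An orthonormal basis of the tangent space at `x`. -/
def frame (x : N) :
    OrthonormalBasis (Fin (Module.finrank ℝ (TangentSpace I x))) ℝ (TangentSpace I x) :=
  stdOrthonormalBasis ℝ (TangentSpace I x)

/-- The musical isomorphism `T*ₓN → TₓN`. -/
def sharp {x : N} (φ : TangentSpace I x → ℝ) : TangentSpace I x :=
  ∑ i, φ (frame I x i) • frame I x i

theorem inner_sharp {x : N} (φ : TangentSpace I x →L[ℝ] ℝ) (v : TangentSpace I x) :
    ⟪sharp I φ, v⟫_ℝ = φ v := by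
  conv_rhs => rw [← (frame I x).sum_repr' v]
  simp [sharp, sum_inner, inner_smul_left, mul_comm]

/-- The gradient of a function. -/
def grad (f : N → ℝ) (x : N) : TangentSpace I x := sharp I (d I f x)

/-- The squared pointwise norm `|α|²` of a 1-form. -/
def normSq (α : ∀ x : N, TangentSpace I x →L[ℝ] ℝ) (x : N) : ℝ := ‖sharp I (α x)‖ ^ 2

/-- The right-hand side of the Koszul formula for `⟨∇_X Y, Z⟩` at `x`. -/
def koszul (X Y Z : ∀ x : N, TangentSpace I x) (x : N) : ℝ :=
  (d I (fun y ↦ ⟪Y y, Z y⟫_ℝ) x (X x) + d I (fun y ↦ ⟪Z y, X y⟫_ℝ) x (Y x)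
    - d I (fun y ↦ ⟪X y, Y y⟫_ℝ) x (Z x)
    + ⟪VectorField.mlieBracket I X Y x, Z x⟫_ℝ
    - ⟪VectorField.mlieBracket I X Z x, Y x⟫_ℝ
    - ⟪VectorField.mlieBracket I Y Z x, X x⟫_ℝ) / 2

end Metric

variable [IsManifold I ∞ N]

/-- A vector field whose value at `x` is `v`: it is constant in the trivialization of the tangent
bundle given by the preferred chart at `x`, hence smooth near `x`. The tensors defined below by
means of such fields do not depend on the extension used. -/
def ext {x : N} (v : TangentSpace I x) : ∀ y : N, TangentSpace I y :=
  FiberBundle.extend E v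

/-- The exterior derivative of a 1-form. -/
def extdOne (α : ∀ x : N, TangentSpace I x →L[ℝ] ℝ) (x : N) (v w : TangentSpace I x) : ℝ :=
  d I (fun y ↦ α y (ext I w y)) x v - d I (fun y ↦ α y (ext I v y)) x w
    - α x (VectorField.mlieBracket I (ext I v) (ext I w) x)

variable [RiemannianBundle (fun x : N ↦ TangentSpace I x)]

/-- The Levi-Civita connection: `nabla I Y x v` is `∇_v Y` at `x`, the vector whose inner product
with each `w` is given by the Koszul formula. -/
def nabla (Y : ∀ x : N, TangentSpace I x) (x : N) (v : TangentSpace I x) : TangentSpace I x :=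
  sharp I fun w ↦ koszul I (ext I v) Y (ext I w) x

/-- The curvature tensor `R(u,v)w = ∇_u ∇_v w - ∇_v ∇_u w - ∇_[u,v] w`. -/
def curvature (x : N) (u v w : TangentSpace I x) : TangentSpace I x :=
  nabla I (fun y ↦ nabla I (ext I w) y (ext I v y)) x u
    - nabla I (fun y ↦ nabla I (ext I w) y (ext I u y)) x v
    - nabla I (ext I w) x (VectorField.mlieBracket I (ext I u) (ext I v) x)

/-- The Ricci operator `Ricci(v) = ∑ᵢ R(v,eᵢ)eᵢ`. -/
def ricci (x : N) (v : TangentSpace I x) : TangentSpace I x :=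
  ∑ i, curvature I x v (frame I x i) (frame I x i)

variable (N) in
/-- `N` is an Einstein manifold: `Ricci = c · id` for a constant `c`. -/
def IsEinstein : Prop := ∃ c : ℝ, ∀ (x : N) (v : TangentSpace I x), ricci I x v = c • v

/-- `(∇_v α)(w)` for a 1-form `α`. -/
def nablaOne (α : ∀ x : N, TangentSpace I x →L[ℝ] ℝ) (x : N) (v w : TangentSpace I x) : ℝ :=
  d I (fun y ↦ α y (ext I w y)) x v - α x (nabla I (ext I w) x v)

/-- The codifferential `d*` of a 1-form. -/
def codiffOne (α : ∀ x : N, TangentSpace I x →L[ℝ] ℝ) (x : N) : ℝ :=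
  -∑ i, nablaOne I α x (frame I x i) (frame I x i)

/-- `(∇_v β)(u, w)` for a 2-form `β`. -/
def nablaTwo (β : ∀ x : N, TangentSpace I x → TangentSpace I x → ℝ) (x : N)
    (v u w : TangentSpace I x) : ℝ :=
  d I (fun y ↦ β y (ext I u y) (ext I w y)) x v - β x (nabla I (ext I u) x v) w
    - β x u (nabla I (ext I w) x v)

/-- The codifferential `d*` of a 2-form. -/
def codiffTwo (β : ∀ x : N, TangentSpace I x → TangentSpace I x → ℝ) (x : N)
    (w : TangentSpace I x) : ℝ :=
  -∑ i, nablaTwo I β x (frame I x i) (frame I x i) w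

/-- The Hodge Laplacian `Δα = d d*α + d* dα` of a 1-form. -/
def hodgeLaplacian (α : ∀ x : N, TangentSpace I x →L[ℝ] ℝ) (x : N) (w : TangentSpace I x) : ℝ :=
  d I (codiffOne I α) x w + codiffTwo I (extdOne I α) x w

/-- The Laplacian of a function, `Δf = d* df` (minus the trace of the Hessian). -/
def laplacian (f : N → ℝ) (x : N) : ℝ := codiffOne I (d I f) x

/-- The equation of 1-forms, for `α = dρ` and `n = dim N`,
`-Δα + (6-n)/2 d|α|² + (2 d*α + (2-n)|α|²) α + 2 (Ricci α♯)♭ = 0`. -/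
def BiharmonicEquation (n : ℕ) (ρ : N → ℝ) : Prop :=
  ∀ (x : N) (w : TangentSpace I x),
    -hodgeLaplacian I (d I ρ) x w + (6 - (n : ℝ)) / 2 * d I (normSq I (d I ρ)) x w
      + (2 * codiffOne I (d I ρ) x + (2 - (n : ℝ)) * normSq I (d I ρ) x) * d I ρ x w
      + 2 * ⟪ricci I x (sharp I (d I ρ x)), w⟫_ℝ = 0

/-- `grad |grad ρ|` is parallel to `grad ρ` wherever `grad ρ ≠ 0`. -/
def GradNormParallel (ρ : N → ℝ) : Prop :=
  ∀ q : N, grad I ρ q ≠ 0 → ∃ c : ℝ, grad I (fun x ↦ ‖grad I ρ x‖) q = c • grad I ρ q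

/-- On `U`, `|dρ|² = γ ∘ ρ` and `Δρ = σ ∘ ρ` for smooth functions `γ`, `σ` of one variable. -/
def IsoparametricOn (ρ : N → ℝ) (U : Set N) : Prop :=
  ∃ γ σ : ℝ → ℝ, ContDiffOn ℝ ∞ γ (ρ '' U) ∧ ContDiffOn ℝ ∞ σ (ρ '' U) ∧
    ∀ q ∈ U, normSq I (d I ρ) q = γ (ρ q) ∧ laplacian I ρ q = σ (ρ q)

end

end Riem

open Filter Topology Set

section VectorSpace

variable {E : Type*} [NormedAddCommGroup E] [NormedSpace ℝ E]

theorem exists_apply_eq_one_of_ne_zero {φ : E →L[ℝ] ℝ} (h : φ ≠ 0) : ∃ v, φ v = 1 := by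
  obtain ⟨w, hw⟩ : ∃ w, φ w ≠ 0 := by
    by_contra! H
    exact h (ContinuousLinearMap.ext H)
  exact ⟨(φ w)⁻¹ • w, by simp [hw]⟩

/-- Near a regular point of `g`, a function whose differential is everywhere a multiple of that of
`g` is constant on the level sets of `g`. -/
theorem exists_mem_nhds_eq_of_fderiv_eq_smul [CompleteSpace E] {g h : E → ℝ} {x₀ : E} (hg : ContDiffAt ℝ 1 g x₀)
    (hg₀ : fderiv ℝ g x₀ ≠ 0) (hh : ∀ᶠ x in 𝓝 x₀, DifferentiableAt ℝ h x)
    (hgh : ∀ᶠ x in 𝓝 x₀, ∃ c : ℝ, fderiv ℝ h x = c • fderiv ℝ g x) :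
    ∃ V ∈ 𝓝 x₀, ∀ a ∈ V, ∀ b ∈ V, g a = g b → h a = h b := by
  set L := fderiv ℝ g x₀ with hL
  obtain ⟨v, hv⟩ := exists_apply_eq_one_of_ne_zero hg₀
  set Φ : E → E := fun x ↦ x + (g x - L x) • v with hΦ
  have hLΦ (x : E) : L (Φ x) = g x := by simp [hΦ, hv]
  have hΦc : ContDiffAt ℝ 1 Φ x₀ :=
    contDiffAt_id.add ((hg.sub L.contDiff.contDiffAt).smul contDiffAt_const)
  have hΦ' : HasFDerivAt Φ ((ContinuousLinearEquiv.refl ℝ E : E ≃L[ℝ] E) : E →L[ℝ] E) x₀ := by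
    have h1 := (hasFDerivAt_id (𝕜 := ℝ) x₀).add
      ((((hg.differentiableAt one_ne_zero).hasFDerivAt).sub L.hasFDerivAt).smul_const v)
    refine h1.congr_fderiv ?_
    ext w
    simp [hL]
  set e := hΦc.toOpenPartialHomeomorph Φ hΦ' one_ne_zero with he
  have hex : x₀ ∈ e.source := hΦc.mem_toOpenPartialHomeomorph_source hΦ' one_ne_zero
  have heΦ : ∀ x, e x = Φ x := fun x ↦ rfl
  have hesymm : ContDiffAt ℝ 1 e.symm (Φ x₀) := hΦc.to_localInverse hΦ' one_ne_zero
  have hcont : Tendsto e.symm (𝓝 (Φ x₀)) (𝓝 x₀) := by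
    have h1 := hesymm.continuousAt.tendsto
    rwa [← heΦ, e.left_inv hex] at h1
  have hgd : ∀ᶠ x in 𝓝 x₀, DifferentiableAt ℝ g x :=
    (hg.eventually (by simp)).mono fun x hx ↦ hx.differentiableAt one_ne_zero
  have hsd : ∀ᶠ y in 𝓝 (Φ x₀), DifferentiableAt ℝ e.symm y :=
    (hesymm.eventually (by simp)).mono fun x hx ↦ hx.differentiableAt one_ne_zero
  have htgt : ∀ᶠ y in 𝓝 (Φ x₀), y ∈ e.target :=
    e.open_target.mem_nhds (by rw [← heΦ]; exact e.map_source hex)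
  obtain ⟨r, hr, hball⟩ := Metric.eventually_nhds_iff_ball.1
    (hsd.and ((eventually_eventually_nhds.2 htgt).and
      ((hcont.eventually hgd).and ((hcont.eventually hh).and (hcont.eventually hgh)))))
  refine ⟨e.source ∩ Φ ⁻¹' Metric.ball (Φ x₀) r, inter_mem (e.open_source.mem_nhds hex)
    (hΦc.continuousAt (Metric.ball_mem_nhds _ hr)), ?_⟩
  rintro a ⟨ha, ha'⟩ b ⟨hb, hb'⟩ hab
  set k : E := Φ a - Φ b with hk
  have hLk : L k = 0 := by simp [hk, hLΦ, hab]
  have hseg : ∀ s ∈ Icc (0 : ℝ) 1, Φ b + s • k ∈ Metric.ball (Φ x₀) r := fun s hs ↦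
    (convex_ball (Φ x₀) r).add_smul_sub_mem hb' ha' hs
  have hderiv : ∀ s ∈ Icc (0 : ℝ) 1,
      HasDerivWithinAt (fun s : ℝ ↦ h (e.symm (Φ b + s • k))) 0 (Icc 0 1) s := by
    intro s hs
    obtain ⟨h1, h2, h3, h4, c, hc⟩ := hball _ (hseg s hs)
    have hgs : (fun y ↦ g (e.symm y)) =ᶠ[𝓝 (Φ b + s • k)] L := by
      filter_upwards [h2] with y hy
      rw [← hLΦ, ← heΦ, e.right_inv hy]
    have hg0 : fderiv ℝ g (e.symm (Φ b + s • k)) (fderiv ℝ e.symm (Φ b + s • k) k) = 0 := by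
      have h5 := (h3.hasFDerivAt.comp _ h1.hasFDerivAt).unique
        (L.hasFDerivAt.congr_of_eventuallyEq hgs)
      rw [← hLk, ← h5]
      rfl
    have hline : HasDerivAt (fun s : ℝ ↦ Φ b + s • k) k s := by
      simpa using ((hasDerivAt_id s).smul_const k).const_add (Φ b)
    have h6 := (h4.hasFDerivAt.comp _ h1.hasFDerivAt).comp_hasDerivAt s hline
    refine (h6.congr_deriv ?_).hasDerivWithinAt
    simp [hc, hg0]
  have hconst := (convex_Icc (0 : ℝ) 1).norm_image_sub_le_of_norm_hasDerivWithin_le (C := 0)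
    hderiv (by simp) (left_mem_Icc.2 zero_le_one) (right_mem_Icc.2 zero_le_one)
  have h7 : h (e.symm (Φ a)) = h (e.symm (Φ b)) := by
    simpa [hk, sub_eq_zero] using hconst
  rwa [← heΦ, ← heΦ, e.left_inv ha, e.left_inv hb] at h7

/-- If `γ ∘ g` is smooth near a regular point of `g`, then `γ` is smooth. -/
theorem contDiffAt_of_eventually_comp_eq {n : WithTop ℕ∞} (hn : n ≠ 0) {g h : E → ℝ} {γ : ℝ → ℝ}
    {x₀ : E} (hg : ContDiffAt ℝ n g x₀) (hh : ContDiffAt ℝ n h x₀) (hg₀ : fderiv ℝ g x₀ ≠ 0)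
    (hγ : ∀ᶠ x in 𝓝 x₀, γ (g x) = h x) : ContDiffAt ℝ n γ (g x₀) := by
  obtain ⟨v, hv⟩ := exists_apply_eq_one_of_ne_zero hg₀
  set c : ℝ → E := fun s ↦ x₀ + s • v with hc
  have hc0 : c 0 = x₀ := by simp [hc]
  have hcc : ContDiff ℝ n c := by fun_prop
  have hr : ContDiffAt ℝ n (g ∘ c) 0 :=
    ContDiffAt.comp _ (by rwa [hc0]) hcc.contDiffAt
  have hcd : HasDerivAt c v 0 := by
    simpa [hc] using ((hasDerivAt_id (0 : ℝ)).smul_const v).const_add x₀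
  have hr' : HasFDerivAt (g ∘ c)
      ((ContinuousLinearEquiv.refl ℝ ℝ : ℝ ≃L[ℝ] ℝ) : ℝ →L[ℝ] ℝ) 0 := by
    have h0 : HasFDerivAt g (fderiv ℝ g x₀) (c 0) := by
      rw [hc0]; exact (hg.differentiableAt hn).hasFDerivAt
    have h1 := h0.comp_hasDerivAt (0 : ℝ) hcd
    refine h1.hasFDerivAt.congr_fderiv ?_
    ext
    simp [hv]
  set e := hr.toOpenPartialHomeomorph (g ∘ c) hr' hn with he
  have h0e : (0 : ℝ) ∈ e.source := hr.mem_toOpenPartialHomeomorph_source hr' hn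
  have hex : ∀ x, e x = g (c x) := fun x ↦ rfl
  have he0 : e 0 = g x₀ := by rw [hex, hc0]
  have hsymm : ContDiffAt ℝ n e.symm (g x₀) := by
    rw [← he0]; exact hr.to_localInverse hr' hn
  have hsymm0 : e.symm (g x₀) = 0 := by rw [← he0, e.left_inv h0e]
  have htgt : ∀ᶠ t in 𝓝 (g x₀), t ∈ e.target :=
    e.open_target.mem_nhds (by rw [← he0]; exact e.map_source h0e)
  have htend : Tendsto (fun t ↦ c (e.symm t)) (𝓝 (g x₀)) (𝓝 x₀) := by
    have h1 := (hcc.continuous.continuousAt.comp hsymm.continuousAt).tendsto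
    simpa [Function.comp_def, hsymm0, hc0] using h1
  have hev : γ =ᶠ[𝓝 (g x₀)] fun t ↦ h (c (e.symm t)) := by
    filter_upwards [htgt, htend.eventually hγ] with t ht ht'
    rw [← ht', ← hex, e.right_inv ht]
  refine ContDiffAt.congr_of_eventuallyEq ?_ hev
  refine ContDiffAt.comp _ ?_ (hcc.contDiffAt.comp _ hsymm)
  rwa [hsymm0, hc0]

end VectorSpace

namespace Riem

section Submersion

variable {E : Type*} [NormedAddCommGroup E] [NormedSpace ℝ E]
  {H : Type*} [TopologicalSpace H] {I : ModelWithCorners ℝ E H}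
  {N : Type*} [TopologicalSpace N] [ChartedSpace H N]

theorem eventually_extChartAt_symm {p : N → Prop} {q : N} (h : ∀ᶠ x in 𝓝 q, p x) :
    ∀ᶠ y in 𝓝 (extChartAt I q q), p ((extChartAt I q).symm y) := by
  have h1 := (continuousAt_extChartAt_symm (I := I) q).tendsto
  rw [extChartAt_to_inv] at h1
  exact h1.eventually h

variable [I.Boundaryless]

theorem contDiffAt_comp_extChartAt_symm {n : WithTop ℕ∞} {f : N → ℝ} {q : N}
    (hf : CMDiffAt n f q) :
    ContDiffAt ℝ n (f ∘ (extChartAt I q).symm) (extChartAt I q q) := by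
  have h1 := (contMDiffAt_iff.1 hf).2
  rwa [I.range_eq_univ, contDiffWithinAt_univ] at h1

theorem d_eq_fderiv {f : N → ℝ} {q : N} (hf : MDiffAt f q) :
    d I f q = fderiv ℝ (f ∘ (extChartAt I q).symm) (extChartAt I q q) := by
  have h1 := hf.mvfderiv
  rw [I.range_eq_univ, fderivWithin_univ] at h1
  exact h1

theorem contDiffOn_of_comp_eq {ρ f : N → ℝ} {V : Set N} {γ : ℝ → ℝ} (hV : IsOpen V)
    (hρ : CMDiff[V] ∞ ρ) (hf : CMDiff[V] ∞ f) (hρ₀ : ∀ q ∈ V, d I ρ q ≠ 0)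
    (hγ : ∀ q ∈ V, f q = γ (ρ q)) : ContDiffOn ℝ ∞ γ (ρ '' V) := by
  rintro _ ⟨q, hq, rfl⟩
  have hρ' := hρ.contMDiffAt (hV.mem_nhds hq)
  have hf' := hf.contMDiffAt (hV.mem_nhds hq)
  have h1 := contDiffAt_of_eventually_comp_eq (γ := γ) (by simp)
    (contDiffAt_comp_extChartAt_symm hρ')
    (contDiffAt_comp_extChartAt_symm hf')
    (by rw [← d_eq_fderiv (hρ'.mdifferentiableAt (by simp))]; exact hρ₀ q hq)
    (by
      filter_upwards [eventually_extChartAt_symm (I := I) (hV.mem_nhds hq)] with y hy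
      exact (hγ _ hy).symm)
  rw [Function.comp_apply, extChartAt_to_inv] at h1
  exact h1.contDiffWithinAt

/-- A smooth function that is constant on the level sets of a submersion `ρ` is a smooth function
of `ρ`. -/
theorem exists_contDiffOn_comp_eq {ρ f : N → ℝ} {V : Set N} (hV : IsOpen V)
    (hρ : CMDiff[V] ∞ ρ) (hf : CMDiff[V] ∞ f) (hρ₀ : ∀ q ∈ V, d I ρ q ≠ 0)
    (hfρ : ∀ a ∈ V, ∀ b ∈ V, ρ a = ρ b → f a = f b) :
    ∃ γ : ℝ → ℝ, ContDiffOn ℝ ∞ γ (ρ '' V) ∧ ∀ q ∈ V, f q = γ (ρ q) := by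
  have hfac : Function.FactorsThrough (V.domRestrict f) (V.domRestrict ρ) :=
    fun a b hab ↦ hfρ a a.2 b b.2 hab
  have h1 : ∀ q ∈ V, f q = Function.extend (V.domRestrict ρ) (V.domRestrict f) 0 (ρ q) :=
    fun q hq ↦ (hfac.extend_apply 0 ⟨q, hq⟩).symm
  exact ⟨_, contDiffOn_of_comp_eq hV hρ hf hρ₀ h1, h1⟩

variable [IsManifold I ∞ N]

theorem mdifferentiableAt_extChartAt_symm {q : N} {y : E} (hy : y ∈ (extChartAt I q).target) :
    MDifferentiableAt 𝓘(ℝ, E) I (extChartAt I q).symm y := by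
  have h1 := mdifferentiableWithinAt_extChartAt_symm (I := I) hy
  rwa [I.range_eq_univ, mdifferentiableWithinAt_univ] at h1

theorem fderiv_comp_extChartAt_symm {f : N → ℝ} {q : N} {y : E}
    (hy : y ∈ (extChartAt I q).target) (hf : MDiffAt f ((extChartAt I q).symm y)) (w : E) :
    DifferentiableAt ℝ (f ∘ (extChartAt I q).symm) y ∧
    fderiv ℝ (f ∘ (extChartAt I q).symm) y w =
      d I f ((extChartAt I q).symm y) (mfderiv 𝓘(ℝ, E) I (extChartAt I q).symm y w) := by
  have h1 := mdifferentiableAt_extChartAt_symm hy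
  refine ⟨mdifferentiableAt_iff_differentiableAt.1 (hf.comp y h1), ?_⟩
  rw [← mfderiv_eq_fderiv]
  exact mfderiv_comp_apply y hf h1 w

variable [CompleteSpace E]

theorem exists_isOpen_eq_of_d_eq_smul {ρ f : N → ℝ} {q : N} {O : Set N} (hO : IsOpen O)
    (hq : q ∈ O) (hρ : CMDiff[O] ∞ ρ) (hf : CMDiff[O] ∞ f) (hρ₀ : d I ρ q ≠ 0)
    (hfρ : ∀ x ∈ O, ∃ c : ℝ, d I f x = c • d I ρ x) :
    ∃ V ⊆ O, IsOpen V ∧ q ∈ V ∧ ∀ a ∈ V, ∀ b ∈ V, ρ a = ρ b → f a = f b := by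
  have hρ' : ∀ x ∈ O, CMDiffAt ∞ ρ x := fun x hx ↦ hρ.contMDiffAt (hO.mem_nhds hx)
  have hf' : ∀ x ∈ O, CMDiffAt ∞ f x := fun x hx ↦ hf.contMDiffAt (hO.mem_nhds hx)
  have htgt : ∀ᶠ y in 𝓝 (extChartAt I q q), y ∈ (extChartAt I q).target :=
    extChartAt_target_mem_nhds q
  have hOy := eventually_extChartAt_symm (I := I) (hO.mem_nhds hq)
  obtain ⟨W, hW, hWc⟩ := exists_mem_nhds_eq_of_fderiv_eq_smul
    (g := ρ ∘ (extChartAt I q).symm) (h := f ∘ (extChartAt I q).symm)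
    ((contDiffAt_comp_extChartAt_symm (hρ' q hq)).of_le (by simp))
    (by rwa [← d_eq_fderiv ((hρ' q hq).mdifferentiableAt (by simp))])
    (by
      filter_upwards [htgt, hOy] with y hy hy'
      exact (fderiv_comp_extChartAt_symm hy ((hf' _ hy').mdifferentiableAt (by simp)) 0).1)
    (by
      filter_upwards [htgt, hOy] with y hy hy'
      obtain ⟨c, hc⟩ := hfρ _ hy'
      refine ⟨c, ?_⟩
      ext w
      rw [(fderiv_comp_extChartAt_symm hy ((hf' _ hy').mdifferentiableAt (by simp)) w).2, hc,
        smul_apply, smul_apply,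
        (fderiv_comp_extChartAt_symm hy ((hρ' _ hy').mdifferentiableAt (by simp)) w).2])
  have hmem : O ∩ ((extChartAt I q).source ∩ extChartAt I q ⁻¹' W) ∈ 𝓝 q :=
    inter_mem (hO.mem_nhds hq) (inter_mem (extChartAt_source_mem_nhds q)
      ((continuousAt_extChartAt q).preimage_mem_nhds hW))
  obtain ⟨V, hVs, hV, hqV⟩ := mem_nhds_iff.1 hmem
  refine ⟨V, fun x hx ↦ (hVs hx).1, hV, hqV, fun a ha b hb hab ↦ ?_⟩
  have h1 := hWc _ (hVs ha).2.2 _ (hVs hb).2.2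
  simp only [Function.comp_apply, (extChartAt I q).left_inv (hVs ha).2.1,
    (extChartAt I q).left_inv (hVs hb).2.1] at h1
  exact h1 hab

theorem eq_of_isPreconnected_level {ρ f : N → ℝ} {U : Set N} (hU : IsOpen U)
    (hρ : CMDiff[U] ∞ ρ) (hf : CMDiff[U] ∞ f) (hρ₀ : ∀ q ∈ U, d I ρ q ≠ 0)
    (hfρ : ∀ x ∈ U, ∃ c : ℝ, d I f x = c • d I ρ x)
    (hconn : ∀ t : ℝ, IsPreconnected (U ∩ ρ ⁻¹' {t})) :
    ∀ a ∈ U, ∀ b ∈ U, ρ a = ρ b → f a = f b := by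
  intro a ha b hb hab
  refine (hconn (ρ b)).induction₂ (fun x y ↦ f x = f y) ?_ (fun _ _ _ _ _ _ ↦ Eq.trans)
    (fun _ _ _ _ ↦ Eq.symm) ⟨ha, hab⟩ ⟨hb, rfl⟩
  rintro x ⟨hxU, hx⟩
  obtain ⟨V, -, hVo, hxV, hV⟩ := exists_isOpen_eq_of_d_eq_smul hU hxU hρ hf (hρ₀ x hxU) hfρ
  filter_upwards [mem_nhdsWithin_of_mem_nhds (hVo.mem_nhds hxV), self_mem_nhdsWithin] with y hy hy'
  exact hV x hxV y hy (hx.trans hy'.2.symm)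

end Submersion

section LieBracket

variable {E : Type*} [NormedAddCommGroup E] [NormedSpace ℝ E]
  {H : Type*} [TopologicalSpace H] {I : ModelWithCorners ℝ E H} [I.Boundaryless]
  {N : Type*} [TopologicalSpace N] [ChartedSpace H N] [IsManifold I ∞ N]

theorem eventually_d_apply_eq_fderiv {f : N → ℝ} {q : N} (hf : CMDiffAt 2 f q)
    {W : ∀ x : N, TangentSpace I x} {W' : E → E}
    (hW' : W' = VectorField.mpullback 𝓘(ℝ, E) I (extChartAt I q).symm W) :
    ∀ᶠ y in 𝓝 (extChartAt I q q),
      d I f ((extChartAt I q).symm y) (W ((extChartAt I q).symm y)) =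
        fderiv ℝ (f ∘ (extChartAt I q).symm) y (W' y) := by
  have hmf : ∀ᶠ x in 𝓝 q, MDiffAt f x :=
    ((contMDiffAt_iff_contMDiffAt_nhds (by simp)).1 hf).mono
      fun x hx ↦ hx.mdifferentiableAt (by simp)
  filter_upwards [extChartAt_target_mem_nhds (I := I) q, eventually_extChartAt_symm hmf]
    with y hy hy'
  rw [(fderiv_comp_extChartAt_symm hy hy' _).2, hW']
  congr 1
  have hinv : (mfderiv 𝓘(ℝ, E) I (extChartAt I q).symm y).IsInvertible := by
    have h1 := isInvertible_mfderivWithin_extChartAt_symm (I := I) hy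
    rwa [I.range_eq_univ, mfderivWithin_univ] at h1
  exact (hinv.self_apply_inverse _).symm

variable [CompleteSpace E]

theorem differentiableAt_mpullback_extChartAt_symm {q : N} {W : ∀ x : N, TangentSpace I x}
    (hW : MDiffAt (T% W) q) {W' : E → E}
    (hW' : W' = VectorField.mpullback 𝓘(ℝ, E) I (extChartAt I q).symm W) :
    DifferentiableAt ℝ W' (extChartAt I q q) := by
  rw [← mdifferentiableWithinAt_univ] at hW
  have h1 := hW.differentiableWithinAt_mpullbackWithin_vectorField
  rw [I.range_eq_univ, VectorField.mpullbackWithin_univ, preimage_univ, univ_inter, ← hW'] at h1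
  exact h1.differentiableAt univ_mem

theorem d_d_apply {f : N → ℝ} {q : N} (hf : CMDiffAt 2 f q)
    {W : ∀ x : N, TangentSpace I x} (hW : MDiffAt (T% W) q) {W' : E → E}
    (hW' : W' = VectorField.mpullback 𝓘(ℝ, E) I (extChartAt I q).symm W) (v : E) :
    d I (fun y ↦ d I f y (W y)) q v =
      fderiv ℝ (fderiv ℝ (f ∘ (extChartAt I q).symm)) (extChartAt I q q) v
          (W' (extChartAt I q q)) +
        fderiv ℝ (f ∘ (extChartAt I q).symm) (extChartAt I q q)
          (fderiv ℝ W' (extChartAt I q q) v) := by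
  set F := f ∘ (extChartAt I q).symm with hF
  set x₀ := extChartAt I q q with hx₀
  have hF2 : ContDiffAt ℝ 2 F x₀ := contDiffAt_comp_extChartAt_symm hf
  have hF' : DifferentiableAt ℝ (fderiv ℝ F) x₀ :=
    (hF2.fderiv_right (m := 1) (by norm_num)).differentiableAt one_ne_zero
  have hWd := differentiableAt_mpullback_extChartAt_symm hW hW'
  have hev := eventually_d_apply_eq_fderiv hf hW'
  have hG : DifferentiableAt ℝ (fun y ↦ fderiv ℝ F y (W' y)) x₀ := hF'.clm_apply hWd
  have hGφ : (fun y ↦ d I f y (W y)) =ᶠ[𝓝 q]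
      (fun y ↦ fderiv ℝ F y (W' y)) ∘ extChartAt I q := by
    filter_upwards [(continuousAt_extChartAt q).eventually hev, extChartAt_source_mem_nhds (I := I) q]
      with y hy hy'
    rw [(extChartAt I q).left_inv hy'] at hy
    exact hy
  have hmd : MDiffAt (fun y ↦ d I f y (W y)) q :=
    (MDifferentiableAt.comp q hG.mdifferentiableAt
      (mdifferentiableAt_extChartAt (mem_chart_source H q))).congr_of_eventuallyEq hGφ
  have hev' : (fun y ↦ d I f y (W y)) ∘ (extChartAt I q).symm =ᶠ[𝓝 x₀]
      fun y ↦ fderiv ℝ F y (W' y) := hev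
  rw [d_eq_fderiv hmd, hev'.fderiv_eq, fderiv_clm_apply hF' hWd]
  exact add_comm _ _

/-- The Lie bracket of vector fields is the commutator of the associated derivations. -/
theorem d_apply_mlieBracket {f : N → ℝ} {q : N} (hf : CMDiffAt 2 f q)
    {V W : ∀ x : N, TangentSpace I x} (hV : MDiffAt (T% V) q) (hW : MDiffAt (T% W) q) :
    d I f q (VectorField.mlieBracket I V W q) =
      d I (fun y ↦ d I f y (W y)) q (V q) - d I (fun y ↦ d I f y (V y)) q (W q) := by
  set V' : E → E := VectorField.mpullback 𝓘(ℝ, E) I (extChartAt I q).symm V with hV'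
  set W' : E → E := VectorField.mpullback 𝓘(ℝ, E) I (extChartAt I q).symm W with hW'
  have hval : ∀ U : ∀ x : N, TangentSpace I x,
      VectorField.mpullback 𝓘(ℝ, E) I (extChartAt I q).symm U (extChartAt I q q) = U q := by
    intro U
    have h1 := mfderivWithin_extChartAt_symm_inverse_apply (I := I) (x := q)
    rw [I.range_eq_univ, mfderivWithin_univ] at h1
    have h2 : ∀ z, z = q → (U z : E) = U q := by rintro _ rfl; rfl
    exact (h1 _).trans (h2 _ (extChartAt_to_inv q))
  have hbr : VectorField.mlieBracket I V W q =
      fderiv ℝ W' (extChartAt I q q) (V' (extChartAt I q q)) -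
        fderiv ℝ V' (extChartAt I q q) (W' (extChartAt I q q)) := by
    have h1 : (mfderiv I 𝓘(ℝ, E) (extChartAt I q) q).inverse = ContinuousLinearMap.id ℝ E := by
      rw [mfderiv_extChartAt_self]
      exact ContinuousLinearMap.inverse_id
    rw [← VectorField.mlieBracketWithin_univ, VectorField.mlieBracketWithin_apply]
    refine (congrArg (fun A : E →L[ℝ] E ↦ A _) h1).trans ?_
    simp only [I.range_eq_univ, VectorField.mpullbackWithin_univ, preimage_univ, univ_inter]
    exact congrFun (VectorField.lieBracketWithin_univ (V := V') (W := W')) _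
  have hF2 := contDiffAt_comp_extChartAt_symm hf
  have hsymm := hF2.isSymmSndFDerivAt (by simp)
  have h3 : d I f q (VectorField.mlieBracket I V W q) = _ :=
    (congrArg (fun A : E →L[ℝ] ℝ ↦ A _) (d_eq_fderiv (hf.mdifferentiableAt (by simp)))).trans
      (congrArg _ hbr)
  refine h3.trans (Eq.trans ?_ (congrArg₂ (· - ·) (d_d_apply hf hW hW' (V q))
    (d_d_apply hf hV hV' (W q))).symm)
  simp only [hV', hW', hval, map_sub]
  rw [← hV', ← hW']
  have h4 := hsymm.eq (V q) (W q)
  linarith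

end LieBracket

end Riem

section GramSchmidt

open InnerProductSpace

variable {EB : Type*} [NormedAddCommGroup EB] [NormedSpace ℝ EB]
  {HB : Type*} [TopologicalSpace HB] {IB : ModelWithCorners ℝ EB HB} {n : WithTop ℕ∞}
  {B : Type*} [TopologicalSpace B] [ChartedSpace HB B]
  {F : Type*} [NormedAddCommGroup F] [NormedSpace ℝ F]
  {V : B → Type*} [TopologicalSpace (TotalSpace F V)] [∀ x, NormedAddCommGroup (V x)]
  [∀ x, InnerProductSpace ℝ (V x)] [FiberBundle F V] [VectorBundle ℝ F V]
  [IsContMDiffRiemannianBundle IB n F V]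
  {ι : Type*} [LinearOrder ι] [LocallyFiniteOrderBot ι] [WellFoundedLT ι]
  {s : ι → ∀ x, V x} {u : Set B}

theorem contMDiffOn_gramSchmidt (hs : ∀ i, CMDiff[u] n (T% (s i)))
    (hli : ∀ x ∈ u, LinearIndependent ℝ (s · x)) (i : ι) :
    CMDiff[u] n (T% (fun x ↦ gramSchmidt ℝ (s · x) i)) := by
  induction i using WellFoundedLT.induction with
  | ind i ih =>
    have h (x : B) : gramSchmidt ℝ (s · x) i = s i x - ∑ j ∈ Finset.Iio i,
        (⟪gramSchmidt ℝ (s · x) j, s i x⟫_ℝ / ‖gramSchmidt ℝ (s · x) j‖ ^ 2) •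
          gramSchmidt ℝ (s · x) j := by
      rw [gramSchmidt_def]
      simp [Submodule.starProjection_singleton]
    simp only [h]
    refine (hs i).sub_section (ContMDiffOn.sum_section fun j hj ↦ ?_)
    have hj := ih j (Finset.mem_Iio.1 hj)
    refine ContMDiffOn.smul_section (ContMDiffOn.div₀ (hj.inner_bundle (hs i)) ?_ ?_) hj
    · simpa only [← real_inner_self_eq_norm_sq] using! hj.inner_bundle hj
    · intro x hx
      simpa using gramSchmidt_ne_zero j (hli x hx)

theorem contMDiffOn_gramSchmidtNormed (hs : ∀ i, CMDiff[u] n (T% (s i)))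
    (hli : ∀ x ∈ u, LinearIndependent ℝ (s · x)) (i : ι) :
    CMDiff[u] n (T% (fun x ↦ gramSchmidtNormed ℝ (s · x) i)) := by
  have h1 := contMDiffOn_gramSchmidt hs hli i
  have h0 : ∀ x ∈ u, ‖gramSchmidt ℝ (s · x) i‖ ≠ 0 := fun x hx ↦ by
    simpa using gramSchmidt_ne_zero i (hli x hx)
  refine ContMDiffOn.smul_section (ContMDiffOn.inv₀ ?_ h0) h1
  intro x hx
  have h2 := (h1.inner_bundle h1) x hx
  have h3 := (Real.contDiffAt_sqrt (n := n)
    (x := ⟪gramSchmidt ℝ (s · x) i, gramSchmidt ℝ (s · x) i⟫_ℝ)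
    (by simpa using h0 x hx)).contMDiffAt.comp_contMDiffWithinAt x h2
  exact h3.congr_of_mem (fun y _ ↦ norm_eq_sqrt_real_inner (gramSchmidt ℝ (s · y) i)) hx

theorem exists_contMDiffOn_orthonormalBasis [FiniteDimensional ℝ F] [ContMDiffVectorBundle n F V IB]
    (x₀ : B) :
    ∃ u : Set B, IsOpen u ∧ x₀ ∈ u ∧ ∃ e : Fin (Module.finrank ℝ F) → ∀ x, V x,
      (∀ i, CMDiff[u] n (T% (e i))) ∧
      ∀ x ∈ u, ∃ b : OrthonormalBasis (Fin (Module.finrank ℝ F)) ℝ (V x), ∀ i, b i = e i x := by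
  set t := trivializationAt F V x₀
  have hF := t.isLocalFrameOn_localFrame_baseSet IB n (Module.finBasis ℝ F)
  refine ⟨t.baseSet, t.open_baseSet, FiberBundle.mem_baseSet_trivializationAt' x₀,
    fun i x ↦ gramSchmidtNormed ℝ (t.localFrame (Module.finBasis ℝ F) · x) i,
    contMDiffOn_gramSchmidtNormed hF.contMDiffOn fun x hx ↦ hF.linearIndependent hx,
    fun x hx ↦ ⟨OrthonormalBasis.mk (gramSchmidtNormed_orthonormal (hF.linearIndependent hx)) ?_,
      fun i ↦ congrFun (OrthonormalBasis.coe_mk _ _) i⟩⟩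
  rw [span_gramSchmidtNormed_range, span_gramSchmidt]
  exact hF.generating hx

end GramSchmidt

section Trace

variable {F : Type*} [NormedAddCommGroup F] [InnerProductSpace ℝ F]
  {ι κ : Type*} [Fintype ι] [Fintype κ]

theorem OrthonormalBasis.sum_bilin_apply_self [FiniteDimensional ℝ F] (B : F →L[ℝ] F →L[ℝ] ℝ)
    (b : OrthonormalBasis ι ℝ F) (b' : OrthonormalBasis κ ℝ F) :
    ∑ i, B (b i) (b i) = ∑ j, B (b' j) (b' j) := by
  have : CompleteSpace F := FiniteDimensional.complete ℝ F
  let T : F →ₗ[ℝ] F := (InnerProductSpace.toDual ℝ F).symm.toLinearEquiv.toLinearMap ∘ₗ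
    B.toLinearMap
  have hT (v : F) : B v v = ⟪v, T v⟫_ℝ := by
    rw [real_inner_comm]
    exact (InnerProductSpace.toDual_symm_apply (x := v) (y := B v)).symm
  simp_rw [hT, ← LinearMap.trace_eq_sum_inner]

end Trace

namespace Riem

variable {E : Type*} [NormedAddCommGroup E] [NormedSpace ℝ E]
  {H : Type*} [TopologicalSpace H] {I : ModelWithCorners ℝ E H}
  {N : Type*} [TopologicalSpace N] [ChartedSpace H N]

theorem d_mul {f g : N → ℝ} {x : N} (hf : MDiffAt f x) (hg : MDiffAt g x)
    (v : TangentSpace I x) :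
    d I (fun y ↦ f y * g y) x v = f x * d I g x v + g x * d I f x v := by
  rw [d, mvfderiv_fun_mul hf hg]
  rfl

theorem d_add {f g : N → ℝ} {x : N} (hf : MDiffAt f x) (hg : MDiffAt g x)
    (v : TangentSpace I x) :
    d I (fun y ↦ f y + g y) x v = d I f x v + d I g x v := by
  rw [d, mvfderiv_fun_add hf hg]
  rfl

theorem d_congr {f g : N → ℝ} {x : N} (h : f =ᶠ[𝓝 x] g) : d I f x = d I g x := by
  rw [d, d, mvfderiv, mvfderiv, h.mfderiv_eq, h.self_of_nhds]

theorem contMDiffAt_d_apply {n m : WithTop ℕ∞} [IsManifold I 1 N] {f : N → ℝ} (hf : CMDiff n f)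
    (hmn : m + 1 ≤ n) {W : ∀ x : N, TangentSpace I x} {x : N} (hW : CMDiffAt m (T% W) x) :
    CMDiffAt m (fun y ↦ d I f y (W y)) x :=
  (contMDiff_snd_tangentBundle_modelSpace ℝ 𝓘(ℝ, ℝ)).contMDiffAt.comp x
    ((hf.contMDiff_tangentMap hmn).contMDiffAt.comp x hW)

section Metric

variable [FiniteDimensional ℝ E]

variable [RiemannianBundle (fun x : N ↦ TangentSpace I x)]

theorem inner_grad (f : N → ℝ) (x : N) (v : TangentSpace I x) : ⟪grad I f x, v⟫_ℝ = d I f x v :=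
  inner_sharp I _ v

theorem grad_eq_zero_iff {f : N → ℝ} {x : N} : grad I f x = 0 ↔ d I f x = 0 := by
  constructor
  · intro h
    ext v
    rw [← inner_grad, h]
    simp
  · intro h
    rw [← inner_self_eq_zero (𝕜 := ℝ), inner_grad, h]
    rfl

theorem sharp_eq_sum {ι : Type*} [Fintype ι] {x : N} (b : OrthonormalBasis ι ℝ (TangentSpace I x))
    (φ : TangentSpace I x →L[ℝ] ℝ) : sharp I φ = ∑ i, φ (b i) • b i := by
  refine ext_inner_right ℝ fun v ↦ ?_
  rw [inner_sharp]
  conv_lhs => rw [← b.sum_repr' v]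
  simp [sum_inner, inner_smul_left, mul_comm]

variable [IsManifold I ∞ N]

variable [IsContMDiffRiemannianBundle I ∞ E (fun x : N ↦ TangentSpace I x)]

theorem contMDiff_grad {f : N → ℝ} (hf : CMDiff ∞ f) : CMDiff ∞ (T% (grad I f)) := by
  intro x₀
  obtain ⟨u, hu, hx₀, e, he, hb⟩ := exists_contMDiffOn_orthonormalBasis (IB := I) (n := ∞) (F := E)
    (V := fun x : N ↦ TangentSpace I x) x₀
  have h1 : CMDiffAt ∞ (T% (fun y ↦ ∑ i, d I f y (e i y) • e i y)) x₀ :=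
    ContMDiffAt.sum_section fun i _ ↦ by
      have h2 := (he i).contMDiffAt (hu.mem_nhds hx₀)
      exact (contMDiffAt_d_apply hf (by simp) h2).smul_section h2
  refine h1.congr_of_eventuallyEq ?_
  filter_upwards [hu.mem_nhds hx₀] with y hy
  obtain ⟨b, hb⟩ := hb y hy
  rw [grad, sharp_eq_sum b]
  simp_rw [hb]

theorem contMDiff_normSq {f : N → ℝ} (hf : CMDiff ∞ f) : CMDiff ∞ (normSq I (d I f)) := by
  have h1 := ContMDiff.inner_bundle (F := E) (E := fun x : N ↦ TangentSpace I x) (b := fun x ↦ x)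
    (contMDiff_grad hf) (contMDiff_grad hf)
  simpa only [real_inner_self_eq_norm_sq] using! h1

end Metric

end Riem

namespace Riem

section Laplacian

variable {E : Type*} [NormedAddCommGroup E] [NormedSpace ℝ E]
  {H : Type*} [TopologicalSpace H] {I : ModelWithCorners ℝ E H}
  {N : Type*} [TopologicalSpace N] [ChartedSpace H N]

section LieMetric

variable [RiemannianBundle (fun x : N ↦ TangentSpace I x)]

variable (I) in
/-- The Lie derivative of the metric in the direction of `G`, evaluated at `V` and `W`. -/
noncomputable def lieMetric (G V W : ∀ x : N, TangentSpace I x) (x : N) : ℝ :=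
  d I (fun y ↦ ⟪V y, W y⟫_ℝ) x (G x) - ⟪VectorField.mlieBracket I G V x, W x⟫_ℝ
    - ⟪VectorField.mlieBracket I G W x, V x⟫_ℝ

theorem lieMetric_comm (G V W : ∀ x : N, TangentSpace I x) (x : N) :
    lieMetric I G V W x = lieMetric I G W V x := by
  simp only [lieMetric, real_inner_comm]
  ring

end LieMetric

variable [IsManifold I ∞ N]

theorem mdifferentiableAt_ext {x : N} (v : TangentSpace I x) : MDiffAt (T% (ext I v)) x :=
  FiberBundle.mdifferentiableAt_extend I E v

theorem ext_apply_self {x : N} (v : TangentSpace I x) : ext I v x = v :=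
  FiberBundle.extend_apply_self E v

variable [RiemannianBundle (fun x : N ↦ TangentSpace I x)]
  [IsContMDiffRiemannianBundle I ∞ E (fun x : N ↦ TangentSpace I x)]

theorem mdifferentiableAt_inner {V W : ∀ x : N, TangentSpace I x} {x : N}
    (hV : MDiffAt (T% V) x) (hW : MDiffAt (T% W) x) : MDiffAt (fun y ↦ ⟪V y, W y⟫_ℝ) x :=
  MDifferentiableAt.inner_bundle (F := E) (E := fun x : N ↦ TangentSpace I x) (b := fun x ↦ x) hV hW

variable [FiniteDimensional ℝ E]

theorem tensorialAt_koszul {X Y : ∀ x : N, TangentSpace I x} {x : N}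
    (hX : MDiffAt (T% X) x) (hY : MDiffAt (T% Y) x) :
    TensorialAt I E (fun Z ↦ koszul I X Y Z x) x where
  smul {f Z} hf hZ := by
    have := FiniteDimensional.complete ℝ E
    simp only [koszul, Pi.smul_apply', inner_smul_left, inner_smul_right,
      VectorField.mlieBracket_smul_right hf hZ, d_mul hf (mdifferentiableAt_inner hY hZ),
      d_mul hf (mdifferentiableAt_inner hZ hX), inner_add_left, map_smul, smul_eq_mul,
      RCLike.conj_to_real]
    simp only [← d.eq_def, real_inner_comm]
    ring
  add {Z Z'} hZ hZ' := by
    have := FiniteDimensional.complete ℝ E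
    simp only [koszul, Pi.add_apply, inner_add_left, inner_add_right,
      VectorField.mlieBracket_add_right hZ hZ', map_add,
      d_add (mdifferentiableAt_inner hY hZ) (mdifferentiableAt_inner hY hZ'),
      d_add (mdifferentiableAt_inner hZ hX) (mdifferentiableAt_inner hZ' hX)]
    ring

theorem tensorialAt_lieMetric (G : ∀ x : N, TangentSpace I x) {V : ∀ x : N, TangentSpace I x}
    {x : N} (hV : MDiffAt (T% V) x) : TensorialAt I E (fun W ↦ lieMetric I G V W x) x where
  smul {f W} hf hW := by
    have := FiniteDimensional.complete ℝ E
    simp only [lieMetric, Pi.smul_apply', inner_smul_right, inner_smul_left,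
      VectorField.mlieBracket_smul_right hf hW, d_mul hf (mdifferentiableAt_inner hV hW),
      inner_add_left, smul_eq_mul, real_inner_comm, RCLike.conj_to_real]
    simp only [← d.eq_def]
    ring
  add {W W'} hW hW' := by
    have := FiniteDimensional.complete ℝ E
    simp only [lieMetric, Pi.add_apply, inner_add_left, inner_add_right,
      VectorField.mlieBracket_add_right hW hW',
      d_add (mdifferentiableAt_inner hV hW) (mdifferentiableAt_inner hV hW')]
    ring

theorem tensorialAt_lieMetric_left (G : ∀ x : N, TangentSpace I x)
    {W : ∀ x : N, TangentSpace I x} {x : N} (hW : MDiffAt (T% W) x) :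
    TensorialAt I E (fun V ↦ lieMetric I G V W x) x := by
  simp_rw [lieMetric_comm G _ W]
  exact tensorialAt_lieMetric G hW

/-- The Hessian of `f` is half the Lie derivative of the metric along the gradient of `f`. -/
theorem nablaOne_d_apply_self {f : N → ℝ} (hf : CMDiff ∞ f) (x : N) (v : TangentSpace I x) :
    nablaOne I (d I f) x v v = lieMetric I (grad I f) (ext I v) (ext I v) x / 2 := by
  have := FiniteDimensional.complete ℝ E
  have hG : MDiffAt (T% (grad I f)) x := (contMDiff_grad hf).mdifferentiable (by simp) x
  have hv := mdifferentiableAt_ext v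
  have hT := tensorialAt_koszul hv hv
  have h1 : nabla I (ext I v) x v = sharp I (TensorialAt.mkHom _ x hT) := rfl
  have h2 : d I f x (nabla I (ext I v) x v) = koszul I (ext I v) (ext I v) (grad I f) x := by
    rw [← inner_grad, real_inner_comm, h1, inner_sharp, TensorialAt.mkHom_apply hT hG]
  have h3 (y : N) : d I f y (ext I v y) = ⟪ext I v y, grad I f y⟫_ℝ := by
    rw [← inner_grad, real_inner_comm]
  have hswap := VectorField.mlieBracket_swap_apply (I := I) (V := ext I v) (W := grad I f) (x := x)
  rw [nablaOne, h2]
  simp only [h3, koszul, lieMetric, hswap, VectorField.mlieBracket_self, ext_apply_self,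
    inner_neg_left, real_inner_comm (ext I v _), Pi.zero_apply, inner_zero_left]
  ring

theorem laplacian_eq_sum {ι : Type*} [Fintype ι] {f : N → ℝ} (hf : CMDiff ∞ f)
    {e : ι → ∀ x : N, TangentSpace I x} {x : N} (he : ∀ i, MDiffAt (T% (e i)) x)
    (b : OrthonormalBasis ι ℝ (TangentSpace I x)) (hb : ∀ i, b i = e i x) :
    laplacian I f x = -∑ i, lieMetric I (grad I f) (e i) (e i) x / 2 := by
  have h1 := OrthonormalBasis.sum_bilin_apply_self (TensorialAt.mkHom₂
    (fun V W ↦ lieMetric I (grad I f) V W x) x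
    (fun _ h ↦ tensorialAt_lieMetric_left (grad I f) h)
    (fun _ h ↦ tensorialAt_lieMetric (grad I f) h)) (frame I x) b
  simp_rw [hb, TensorialAt.mkHom₂_apply _ _ (he _) (he _)] at h1
  simp_rw [laplacian, codiffOne, nablaOne_d_apply_self hf, ← Finset.sum_div]
  rw [← h1]
  rfl

theorem contMDiff_laplacian {f : N → ℝ} (hf : CMDiff ∞ f) : CMDiff ∞ (laplacian I f) := by
  have := FiniteDimensional.complete ℝ E
  have : IsManifold I (minSmoothness ℝ 2) N := by
    rw [minSmoothness_of_isRCLikeNormedField]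
    infer_instance
  have : IsManifold I (((⊤ : ℕ∞) : WithTop ℕ∞) + 1) N := inferInstanceAs (IsManifold I ∞ N)
  intro x₀
  obtain ⟨u, hu, hx₀, e, he, hb⟩ := exists_contMDiffOn_orthonormalBasis (IB := I) (n := ∞) (F := E)
    (V := fun x : N ↦ TangentSpace I x) x₀
  have he' (i) (x) (hx : x ∈ u) : CMDiffAt ∞ (T% (e i)) x := (he i).contMDiffAt (hu.mem_nhds hx)
  have h1 : CMDiffAt ∞ (fun x ↦ ∑ i, ⟪VectorField.mlieBracket I (grad I f) (e i) x, e i x⟫_ℝ) x₀ :=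
    contMDiffAt_finsetSum fun i _ ↦
      ContMDiffAt.inner_bundle (F := E) (E := fun x : N ↦ TangentSpace I x) (b := fun x ↦ x)
        (ContMDiffAt.mlieBracket_vectorField (m := ⊤) (n := ⊤) (contMDiff_grad hf x₀)
          (he' i x₀ hx₀) (by simp)) (he' i x₀ hx₀)
  refine h1.congr_of_eventuallyEq ?_
  filter_upwards [hu.mem_nhds hx₀] with x hx
  obtain ⟨b, hbx⟩ := hb x hx
  rw [laplacian_eq_sum hf (fun i ↦ (he' i x hx).mdifferentiableAt (by simp)) b hbx,
    ← Finset.sum_neg_distrib]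
  refine Finset.sum_congr rfl fun i _ ↦ ?_
  have h2 : (fun y ↦ ⟪e i y, e i y⟫_ℝ) =ᶠ[𝓝 x] fun _ ↦ 1 := by
    filter_upwards [hu.mem_nhds hx] with y hy
    obtain ⟨b', hb'⟩ := hb y hy
    rw [← hb', real_inner_self_eq_norm_sq, b'.norm_eq_one, one_pow]
  rw [lieMetric, d_congr h2, d, mvfderiv_const, zero_apply]
  ring

theorem isOpen_grad_ne_zero {ρ : N → ℝ} (hρ : CMDiff ∞ ρ) : IsOpen {p : N | grad I ρ p ≠ 0} := by
  have h1 : {p : N | grad I ρ p ≠ 0} = {p | normSq I (d I ρ) p ≠ 0} := by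
    ext p
    exact (pow_ne_zero_iff two_ne_zero |>.trans norm_ne_zero_iff).symm
  rw [h1]
  exact isOpen_ne_fun (contMDiff_normSq hρ).continuous continuous_const

theorem exists_d_normSq_eq_smul {ρ : N → ℝ} (hρ : CMDiff ∞ ρ) (hi : GradNormParallel I ρ) {q : N}
    (hq : grad I ρ q ≠ 0) : ∃ c : ℝ, d I (normSq I (d I ρ)) q = c • d I ρ q := by
  obtain ⟨c, hc⟩ := hi q hq
  have hsq : normSq I (d I ρ) = fun x ↦ ‖grad I ρ x‖ * ‖grad I ρ x‖ := by
    funext x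
    rw [normSq, sq]
    rfl
  have hsqrt : (fun x ↦ ‖grad I ρ x‖) = fun x ↦ √(normSq I (d I ρ) x) := by
    funext x
    rw [hsq, Real.sqrt_mul_self (norm_nonneg _)]
  have h0 : normSq I (d I ρ) q ≠ 0 := by simpa [hsq] using hq
  have hmd : MDiffAt (fun x ↦ ‖grad I ρ x‖) q := by
    rw [hsqrt]
    exact ((Real.contDiffAt_sqrt (n := 1) h0).contMDiffAt.mdifferentiableAt one_ne_zero).comp q
      ((contMDiff_normSq hρ).mdifferentiable (by simp) q)
  refine ⟨2 * ‖grad I ρ q‖ * c, ?_⟩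
  ext w
  have h1 : d I (fun x ↦ ‖grad I ρ x‖) q w = c * d I ρ q w := by
    rw [← inner_grad, ← inner_grad, hc, inner_smul_left, RCLike.conj_to_real]
  rw [hsq, d_mul hmd hmd, h1, smul_apply, smul_eq_mul]
  ring

end Laplacian

section Isoparametric

variable {E : Type*} [NormedAddCommGroup E] [NormedSpace ℝ E]
  {H : Type*} [TopologicalSpace H] {I : ModelWithCorners ℝ E H} [I.Boundaryless]
  {N : Type*} [TopologicalSpace N] [ChartedSpace H N] [IsManifold I ∞ N]

theorem extdOne_d [CompleteSpace E] {f : N → ℝ} (hf : CMDiff ∞ f) : extdOne I (d I f) = fun _ _ _ ↦ 0 := by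
  funext x v w
  rw [extdOne, d_apply_mlieBracket ((hf x).of_le ENat.LEInfty.out) (mdifferentiableAt_ext v)
    (mdifferentiableAt_ext w), ext_apply_self, ext_apply_self, sub_self]

variable [FiniteDimensional ℝ E]
  [RiemannianBundle (fun x : N ↦ TangentSpace I x)]

theorem hodgeLaplacian_d {f : N → ℝ} (hf : CMDiff ∞ f) (x : N) (w : TangentSpace I x) :
    hodgeLaplacian I (d I f) x w = d I (laplacian I f) x w := by
  have := FiniteDimensional.complete ℝ E
  rw [hodgeLaplacian, extdOne_d hf]
  have h0 (v : TangentSpace I x) : d I (fun _ : N ↦ (0 : ℝ)) x v = 0 := by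
    rw [d, mvfderiv_const, zero_apply]
  simp only [codiffTwo, nablaTwo, h0, sub_zero, Finset.sum_const_zero, neg_zero, add_zero]
  rfl

variable [IsContMDiffRiemannianBundle I ∞ E (fun x : N ↦ TangentSpace I x)]

theorem exists_d_laplacian_eq_smul {n : ℕ} (hE : IsEinstein I N) {ρ : N → ℝ} (hρ : CMDiff ∞ ρ)
    (hi : GradNormParallel I ρ) (hb : BiharmonicEquation I n ρ) {q : N}
    (hq : grad I ρ q ≠ 0) : ∃ c : ℝ, d I (laplacian I ρ) q = c • d I ρ q := by
  obtain ⟨c, hc⟩ := hE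
  obtain ⟨k, hk⟩ := exists_d_normSq_eq_smul hρ hi hq
  refine ⟨(6 - (n : ℝ)) / 2 * k + (2 * codiffOne I (d I ρ) q +
    (2 - (n : ℝ)) * normSq I (d I ρ) q) + 2 * c, ?_⟩
  ext w
  have h1 := hb q w
  rw [hodgeLaplacian_d hρ, hc, inner_smul_left, inner_sharp, hk, smul_apply,
    RCLike.conj_to_real, smul_eq_mul] at h1
  rw [smul_apply, smul_eq_mul]
  linear_combination -h1

theorem isoparametricOn_of_eq {ρ : N → ℝ} (hρ : CMDiff ∞ ρ) {U : Set N} (hU : IsOpen U)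
    (hreg : ∀ p ∈ U, grad I ρ p ≠ 0)
    (hs : ∀ a ∈ U, ∀ b ∈ U, ρ a = ρ b → normSq I (d I ρ) a = normSq I (d I ρ) b)
    (hl : ∀ a ∈ U, ∀ b ∈ U, ρ a = ρ b → laplacian I ρ a = laplacian I ρ b) :
    IsoparametricOn I ρ U := by
  have hreg' : ∀ p ∈ U, d I ρ p ≠ 0 := fun p hp h ↦ hreg p hp (grad_eq_zero_iff.2 h)
  obtain ⟨γ, hγ, hγ'⟩ := exists_contDiffOn_comp_eq hU hρ.contMDiffOn
    (contMDiff_normSq hρ).contMDiffOn hreg' hs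
  obtain ⟨σ, hσ, hσ'⟩ := exists_contDiffOn_comp_eq hU hρ.contMDiffOn
    (contMDiff_laplacian hρ).contMDiffOn hreg' hl
  exact ⟨γ, σ, hγ, hσ, fun q hq ↦ ⟨hγ' q hq, hσ' q hq⟩⟩

end Isoparametric

end Riem

theorem mainTheorem8 {n : ℕ} (hn : 2 < n)
    {N : Type*} [TopologicalSpace N] [T2Space N] [SecondCountableTopology N]
    [ChartedSpace (EuclideanSpace ℝ (Fin n)) N] [IsManifold (𝓡 n) ∞ N]
    [RiemannianBundle (fun x : N ↦ TangentSpace (𝓡 n) x)]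
    [IsContMDiffRiemannianBundle (𝓡 n) ∞ (EuclideanSpace ℝ (Fin n))
      (fun x : N ↦ TangentSpace (𝓡 n) x)]
    (hE : Riem.IsEinstein (𝓡 n) N)
    (ρ : N → ℝ) (hρ : ContMDiff (𝓡 n) 𝓘(ℝ, ℝ) ∞ ρ)
    (hi : Riem.GradNormParallel (𝓡 n) ρ)
    (hb : Riem.BiharmonicEquation (𝓡 n) n ρ) :
    (∀ q : N, Riem.grad (𝓡 n) ρ q ≠ 0 →
      ∃ U : Set N, IsOpen U ∧ q ∈ U ∧ (∀ p ∈ U, Riem.grad (𝓡 n) ρ p ≠ 0) ∧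
        Riem.IsoparametricOn (𝓡 n) ρ U) ∧
    (∀ U : Set N, IsOpen U → (∀ p ∈ U, Riem.grad (𝓡 n) ρ p ≠ 0) →
      (∀ t : ℝ, IsPreconnected (U ∩ ρ ⁻¹' {t})) →
        Riem.IsoparametricOn (𝓡 n) ρ U) := by
  have hs := Riem.contMDiff_normSq (I := 𝓡 n) hρ
  have hl := Riem.contMDiff_laplacian (I := 𝓡 n) hρ
  refine ⟨fun q hq ↦ ?_, fun U hU hreg hconn ↦ ?_⟩
  · have hO := Riem.isOpen_grad_ne_zero (I := 𝓡 n) hρ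
    have hq' : Riem.d (𝓡 n) ρ q ≠ 0 := fun h ↦ hq (Riem.grad_eq_zero_iff.2 h)
    obtain ⟨V₁, hV₁s, hV₁, hqV₁, hV₁e⟩ := Riem.exists_isOpen_eq_of_d_eq_smul hO hq
      hρ.contMDiffOn hs.contMDiffOn hq' fun x hx ↦ Riem.exists_d_normSq_eq_smul hρ hi hx
    obtain ⟨V₂, -, hV₂, hqV₂, hV₂e⟩ := Riem.exists_isOpen_eq_of_d_eq_smul hO hq
      hρ.contMDiffOn hl.contMDiffOn hq' fun x hx ↦ Riem.exists_d_laplacian_eq_smul hE hρ hi hb hx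
    exact ⟨V₁ ∩ V₂, hV₁.inter hV₂, ⟨hqV₁, hqV₂⟩, fun p hp ↦ hV₁s hp.1,
      Riem.isoparametricOn_of_eq hρ (hV₁.inter hV₂) (fun p hp ↦ hV₁s hp.1)
        (fun a ha b hb ↦ hV₁e a ha.1 b hb.1) (fun a ha b hb ↦ hV₂e a ha.2 b hb.2)⟩
  · have hreg' : ∀ p ∈ U, Riem.d (𝓡 n) ρ p ≠ 0 :=
      fun p hp h ↦ hreg p hp (Riem.grad_eq_zero_iff.2 h)
    exact Riem.isoparametricOn_of_eq hρ hU hreg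
      (Riem.eq_of_isPreconnected_level hU hρ.contMDiffOn hs.contMDiffOn hreg'
        (fun x hx ↦ Riem.exists_d_normSq_eq_smul hρ hi (hreg x hx)) hconn)
      (Riem.eq_of_isPreconnected_level hU hρ.contMDiffOn hl.contMDiffOn hreg'
        (fun x hx ↦ Riem.exists_d_laplacian_eq_smul hE hρ hi hb (hreg x hx)) hconn)
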